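/- Let $p$ be a prime with $p\equiv 1\pmod 3$, and let $\theta,q\in\mathbb{Q}_p$ satisfy $0<|\theta-1|_p<|q|_p<1$. Put $x^{(\infty)}=2-\theta-q$, $\mathrm{Dom}=\mathbb{Q}_p\setminus\{x^{(\infty)}\}$, and consider the Potts–Bethe map $$f:\mathrm{Dom}\to\mathbb{Q}_p,\qquad f(x)=\left(\frac{\theta x+q-1}{x+\theta+q-2}\right)^3 .$$ For $S\subset\mathbb{Q}_p$ and $n\ge 0$ let $f^{-n}(S)$ be the set of $x$ for which $f^n(x)$ is defined and lies in $S$ (so $f^{0}(S)=S$). Let $x^{(0)}=1$ and let $\mathfrak{B}(x^{(0)})$ be the set of $x$ such that $f^n(x)$ is defined for all $n\ge 0$ and $f^n(x)\to x^{(0)}$. A fixed point $x$ of $f$ is attracting if $|f'(x)|_p<1$ and repelling if $|f'(x)|_p>1$. The cubic equation $$y^3-(1+\theta+\theta^2)y^2-(2\theta+1)(1-\theta-q)y-(1-\theta-q)^2=0$$ has, counted with multiplicity, three roots in $\mathbb{Q}_p$, and they can be numbered $y^{(1)},y^{(2)},y^{(3)}$ with $|y^{(1)}|_p=1$ and $|y^{(2)}|_p=|y^{(3)}|_p=|1-\theta-q|_p$.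 For any such numbering put $x^{(i)}=1-q+(\theta-1)(y^{(i)}-1)$ for $i=1,2,3$, and $$\mathcal{A}_0=\{x\in\mathbb{Q}_p:|x-x^{(0)}|_p<|q|_p\},$$ $$\mathcal{C}_1=\{x\in\mathbb{Q}_p:|x-x^{(1)}|_p<|x-x^{(\infty)}|_p=|\theta-1|_p\},$$ $$\mathcal{C}_i=\{x\in\mathbb{Q}_p:|x-x^{(i)}|_p<|x-x^{(\infty)}|_p=|q|_p|\theta-1|_p\}\quad(i=2,3).$$ Then: (i) $\{x\in\mathrm{Dom}: f(x)=x\}=\{x^{(0)},x^{(1)},x^{(2)},x^{(3)}\}$, and these four points are distinct; $x^{(0)}$ is attracting, and $x^{(1)},x^{(2)},x^{(3)}$ are repelling. (ii) $\mathrm{Dom}\setminus(\mathcal{C}_1\cup\mathcal{C}_2\cup\mathcal{C}_3)\subset\mathfrak{B}(x^{(0)})=\bigcup_{n=0}^{\infty}f^{-n}(\mathcal{A}_0)$. There is a set $\mathcal{J}\subset\mathcal{C}_1\cup\mathcal{C}_2\cup\mathcal{C}_3$ such that: (iii) $f(\mathcal{J})\subset\mathcal{J}$, and $f:\mathcal{J}\to\mathcal{J}$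 is topologically conjugate to the one-sided full shift $(\Sigma_3,\sigma)$ on three symbols, where $\Sigma_3=\{0,1,2\}^{\mathbb{N}}$ carries the product topology and $\sigma$ is the left shift; (iv) $\mathbb{Q}_p=\mathfrak{B}(x^{(0)})\cup\mathcal{J}\cup\bigcup_{n=0}^{\infty}f^{-n}(\{x^{(\infty)}\})$. -/

import Mathlib

open Filter Topology Polynomial

noncomputable section

namespace PottsBethe

variable {p : ℕ} [Fact p.Prime]

/-- The pole `2 - θ - q` of the Potts–Bethe map. -/
def pole (θ q : ℚ_[p]) : ℚ_[p] := 2 - θ - q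

/-- The domain of the Potts–Bethe map: everything but the pole. -/
def dom (θ q : ℚ_[p]) : Set (ℚ_[p]) := {x | x ≠ pole θ q}

/-- The Potts–Bethe map. Only its values on `dom θ q` are meaningful; every notion below that
involves iteration therefore asks explicitly that the orbit stays in the domain. -/
def map (θ q : ℚ_[p]) (k : ℕ) (x : ℚ_[p]) : ℚ_[p] :=
  ((θ * x + q - 1) / (x + θ + q - 2)) ^ k

/-- The set of fixed points of the map (as a map on its domain). -/
def fixedPoints (θ q : ℚ_[p]) (k : ℕ) : Set (ℚ_[p]) :=
  {x | x ∈ dom θ q ∧ map θ q k x = x}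

/-- A fixed point with multiplier of absolute value `< 1`. -/
def IsAttracting (θ q : ℚ_[p]) (k : ℕ) (x : ℚ_[p]) : Prop :=
  x ∈ fixedPoints θ q k ∧ ∃ m : ℚ_[p], HasDerivAt (map θ q k) m x ∧ ‖m‖ < 1

/-- A fixed point with multiplier of absolute value `> 1`. -/
def IsRepelling (θ q : ℚ_[p]) (k : ℕ) (x : ℚ_[p]) : Prop :=
  x ∈ fixedPoints θ q k ∧ ∃ m : ℚ_[p], HasDerivAt (map θ q k) m x ∧ 1 < ‖m‖

/-- The `n`-th preimage `f⁻ⁿ(S)`: the points whose first `n` iterates are defined and whose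
`n`-th iterate lies in `S`. -/
def preimageIter (θ q : ℚ_[p]) (k n : ℕ) (S : Set (ℚ_[p])) : Set (ℚ_[p]) :=
  {x | (∀ i < n, (map θ q k)^[i] x ∈ dom θ q) ∧ (map θ q k)^[n] x ∈ S}

/-- The basin of `a`: the points all of whose iterates are defined and tend to `a`. -/
def basin (θ q : ℚ_[p]) (k : ℕ) (a : ℚ_[p]) : Set (ℚ_[p]) :=
  {x | (∀ n, (map θ q k)^[n] x ∈ dom θ q) ∧
    Tendsto (fun n => (map θ q k)^[n] x) atTop (𝓝 a)}

/-- The cubic `y³ - (1+θ+θ²) y² - (2θ+1)(1-θ-q) y - (1-θ-q)²`. -/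
def cubic (θ q : ℚ_[p]) : (ℚ_[p])[X] :=
  X ^ 3 - C (1 + θ + θ ^ 2) * X ^ 2 - C ((2 * θ + 1) * (1 - θ - q)) * X - C ((1 - θ - q) ^ 2)

/-- `y₁, y₂, y₃` are the roots of the cubic, with multiplicity, numbered so that `y₁` is
the unit and `y₂, y₃` have absolute value `|1-θ-q|`. -/
structure AreRoots (θ q y₁ y₂ y₃ : ℚ_[p]) : Prop where
  roots_eq : (cubic θ q).roots = {y₁, y₂, y₃}
  norm_one : ‖y₁‖ = 1
  norm_two : ‖y₂‖ = ‖1 - θ - q‖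
  norm_three : ‖y₃‖ = ‖1 - θ - q‖

/-- The point `1 - q + (θ-1)(y-1)` attached to a root `y` of the cubic. -/
def pt (θ q y : ℚ_[p]) : ℚ_[p] := 1 - q + (θ - 1) * (y - 1)

/-- The set `{x : |x - 1| < |q|}`. -/
def setA (q : ℚ_[p]) : Set (ℚ_[p]) := {x | ‖x - 1‖ < ‖q‖}

/-- The set `{x : |x - c| < |x - pole| = r}`. -/
def setC (θ q c : ℚ_[p]) (r : ℝ) : Set (ℚ_[p]) :=
  {x | ‖x - c‖ < ‖x - pole θ q‖ ∧ ‖x - pole θ q‖ = r}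

/-- The union `C₁ ∪ C₂ ∪ C₃` attached to the roots `y₁, y₂, y₃`. -/
def unionC (θ q y₁ y₂ y₃ : ℚ_[p]) : Set (ℚ_[p]) :=
  setC θ q (pt θ q y₁) ‖θ - 1‖ ∪ setC θ q (pt θ q y₂) (‖q‖ * ‖θ - 1‖) ∪
    setC θ q (pt θ q y₃) (‖q‖ * ‖θ - 1‖)

/-- The left shift on one-sided sequences in `s` symbols. -/
def shift (s : ℕ) (w : ℕ → Fin s) : ℕ → Fin s := fun n => w (n + 1)

/-- `f` maps `J` to itself, and `f : J → J` (subspace topology) is topologically conjugate to the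
one-sided full shift on `s` symbols (product of the discrete topologies). -/
def ConjugateToFullShift {E : Type*} [TopologicalSpace E] (f : E → E) (J : Set E) (s : ℕ) :
    Prop :=
  ∃ hJ : Set.MapsTo f J J, ∃ h : J ≃ₜ (ℕ → Fin s),
    Function.Semiconj h (hJ.restrict f J J) (shift s)

end PottsBethe

end

noncomputable section

namespace PottsBethe

variable {p : ℕ} [Fact p.Prime]

/-! Expanded at its pole, the map is the cube of `θ - (θ - 1)(θ - 1 + q) / (x - pole)`, and
everything is decided by the closed ball `trap` of radius |θ - 1| about the pole.

A point off the trap is sent into |x - 1| < |q|, where the map contracts towards 1 by the factor |θ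
- 1| / |q|; so leaving the trap with a defined orbit means lying in the basin.

On the trap |x - 1| = |q| < 1, so Hensel gives a cube root near 1, and taking it is isometric
because 3 is a unit. As p ≡ 1 mod 3 there are three cube roots of unity, hence three inverse
branches. They contract the trap into itself with disjoint images, so the points that never leave it
form a full 3-shift (`conjugateToFullShift_of_contractions`).

The fixed points of the branches are the rescaled roots of the cubic (`exists_areRoots`), and each
branch maps the trap into the set C around its fixed point (`mem_unionC_of_map_mem_trap`). -/

/-! ### Symbolic coding by contracting inverse branches -/

/-- If contractions `φ i` of a bounded complete set `K` have disjoint images and are the inverse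
branches of `f` on `K`, then `f` is conjugate to the full shift on the points that never
leave `K`. -/
theorem conjugateToFullShift_of_contractions {E : Type*} [MetricSpace E] {s : ℕ} [NeZero s]
    (f : E → E) (K : Set E) [CompleteSpace K] [Nonempty K] (hK : Bornology.IsBounded K)
    (φ : Fin s → K → K) (r : NNReal) (hφ : ∀ i, ContractingWith r (φ i))
    (hf : ∀ i x, f (φ i x) = x) (hdisj : ∀ i j x y, φ i x = φ j y → i = j)
    (hsurj : ∀ (x : K) (hx : f x ∈ K), ∃ i, x = φ i ⟨f x, hx⟩) :
    ConjugateToFullShift f {x | ∀ n, f^[n] x ∈ K} s := by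
  have hmaps : Set.MapsTo f {x | ∀ n, f^[n] x ∈ K} {x | ∀ n, f^[n] x ∈ K} := by
    intro x hx n
    have := hx (n + 1)
    rwa [Function.iterate_succ_apply] at this
  have hshift : Continuous (shift s) := by
    unfold shift
    fun_prop
  have hφc : Continuous fun z : Fin s × K => φ z.1 z.2 :=
    continuous_prod_of_discrete_left.2 fun i => (hφ i).2.continuous
  -- The coding map solves g(w) = φ_{w 0}(g(shift w)). Solving this by Banach's theorem in the space
  -- of continuous functions gives continuity for free.
  let T : C(ℕ → Fin s, K) → C(ℕ → Fin s, K) := fun g =>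
    ⟨fun w => φ (w 0) (g (shift s w)),
      hφc.comp ((continuous_apply 0).prodMk (g.continuous.comp hshift))⟩
  have hT : ContractingWith r T := by
    refine ⟨(hφ 0).1, LipschitzWith.of_dist_le_mul fun g g' => ?_⟩
    refine (ContinuousMap.dist_le (by positivity)).2 fun w => ?_
    refine ((hφ (w 0)).2.dist_le_mul _ _).trans ?_
    exact mul_le_mul_of_nonneg_left (ContinuousMap.dist_apply_le_dist _) r.2
  have : Nonempty C(ℕ → Fin s, K) := ⟨ContinuousMap.const _ (Classical.arbitrary K)⟩
  obtain ⟨g, hg⟩ : ∃ g, T g = g := ⟨_, hT.fixedPoint_isFixedPt⟩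
  have hgw : ∀ w, g w = φ (w 0) (g (shift s w)) := fun w =>
    (DFunLike.congr_fun hg w).symm
  have hfg : ∀ w, f (g w) = g (shift s w) := fun w => by rw [hgw w, hf]
  have hiter : ∀ n w, f^[n] (g w) = g ((shift s)^[n] w) := by
    intro n
    induction n with
    | zero => intro w; rfl
    | succ n ih => intro w; rw [Function.iterate_succ_apply, hfg, ih, Function.iterate_succ_apply]
  have hmem : ∀ w, (g w : E) ∈ {x | ∀ n, f^[n] x ∈ K} := fun w n => by
    rw [hiter]
    exact (g _).2
  have hshift_iter : ∀ n (w : ℕ → Fin s), ((shift s)^[n] w) 0 = w n := by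
    intro n
    induction n with
    | zero => intro w; rfl
    | succ n ih => intro w; rw [Function.iterate_succ_apply, ih]; rfl
  let G : (ℕ → Fin s) → {x | ∀ n, f^[n] x ∈ K} := fun w => ⟨g w, hmem w⟩
  have hGc : Continuous G := (continuous_subtype_val.comp g.continuous).subtype_mk _
  have hinj : Function.Injective G := by
    intro w w' h
    have h0 : (g w : E) = g w' :=
      show (G w : E) = G w' by rw [h]
    funext n
    have h1 : g ((shift s)^[n] w) = g ((shift s)^[n] w') :=
      Subtype.ext (by rw [← hiter, ← hiter, h0])
    rw [hgw, hgw ((shift s)^[n] w')] at h1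
    simpa only [hshift_iter] using hdisj _ _ _ _ h1
  have hGsurj : Function.Surjective G := by
    rintro ⟨x, hx⟩
    have hstep : ∀ n, f (f^[n] x) ∈ K := fun n => by
      rw [← Function.iterate_succ_apply' f]; exact hx (n + 1)
    choose w hw using fun n => hsurj ⟨f^[n] x, hx n⟩ (hstep n)
    refine ⟨w, Subtype.ext ?_⟩
    -- With w the itinerary of x, both points are images under the same n branches, so their
    -- distance is at most r ^ n times the diameter of K.
    have key : ∀ n, dist (g w) ⟨x, hx 0⟩ ≤
        r ^ n * dist (g ((shift s)^[n] w)) ⟨f^[n] x, hx n⟩ := by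
      intro n
      induction n with
      | zero => simp
      | succ n ih =>
        refine ih.trans ?_
        rw [pow_succ, mul_assoc]
        refine mul_le_mul_of_nonneg_left ?_ (by positivity)
        rw [hgw, hw n, hshift_iter, ← Function.iterate_succ_apply' (shift s)]
        refine ((hφ (w n)).2.dist_le_mul _ _).trans (le_of_eq ?_)
        congr 3
        exact (Function.iterate_succ_apply' f n x).symm
    have hlim : Tendsto (fun n : ℕ => (r : ℝ) ^ n * Metric.diam K) atTop (𝓝 0) := by
      simpa using (tendsto_pow_atTop_nhds_zero_of_lt_one r.2
        (NNReal.coe_lt_one.2 (hφ (w 0)).1)).mul_const (Metric.diam K)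
    have hle : dist (g w) ⟨x, hx 0⟩ ≤ 0 := ge_of_tendsto' hlim fun n =>
      (key n).trans (mul_le_mul_of_nonneg_left
        (Metric.dist_le_diam_of_mem hK (g _).2 (hx n)) (by positivity))
    exact congrArg Subtype.val (dist_le_zero.1 hle)
  let e := Equiv.ofBijective G ⟨hinj, hGsurj⟩
  let h : (ℕ → Fin s) ≃ₜ {x | ∀ n, f^[n] x ∈ K} :=
    Continuous.homeoOfEquivCompactToT2 (f := e) hGc
  refine ⟨hmaps, h.symm, fun x => ?_⟩
  obtain ⟨w, rfl⟩ := h.surjective x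
  rw [h.symm_apply_apply, Homeomorph.symm_apply_eq]
  exact Subtype.ext (hfg w)

/-! ### Ultrametric estimates and cube roots near 1 -/

theorem norm_add_eq_of_lt {x y : ℚ_[p]} (h : ‖x‖ < ‖y‖) : ‖x + y‖ = ‖y‖ := by
  rw [Padic.add_eq_max_of_ne h.ne, max_eq_right h.le]

theorem norm_add_lt {x y : ℚ_[p]} {r : ℝ} (hx : ‖x‖ < r) (hy : ‖y‖ < r) : ‖x + y‖ < r :=
  (Padic.nonarchimedean x y).trans_lt (max_lt hx hy)

theorem norm_add_le {x y : ℚ_[p]} {r : ℝ} (hx : ‖x‖ ≤ r) (hy : ‖y‖ ≤ r) : ‖x + y‖ ≤ r :=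
  (Padic.nonarchimedean x y).trans (max_le hx hy)

theorem norm_eq_one_of_norm_sub_one_lt {x : ℚ_[p]} (h : ‖x - 1‖ < 1) : ‖x‖ = 1 := by
  have := norm_add_eq_of_lt (x := x - 1) (y := 1) (by rwa [norm_one])
  rwa [sub_add_cancel, norm_one] at this

theorem coprime_three (hp : p ≡ 1 [MOD 3]) : p.Coprime 3 := by
  refine ((Nat.coprime_primes (Fact.out : p.Prime) Nat.prime_three).2 ?_)
  rintro rfl
  exact absurd hp (by decide)

theorem norm_three (hp : p ≡ 1 [MOD 3]) : ‖(3 : ℚ_[p])‖ = 1 := by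
  exact_mod_cast (Padic.norm_natCast_eq_one_iff (p := p) (n := 3)).2 (coprime_three hp)

theorem norm_three_int (hp : p ≡ 1 [MOD 3]) : ‖(3 : ℤ_[p])‖ = 1 := by
  rw [PadicInt.norm_def]
  exact_mod_cast norm_three hp

theorem exists_cubeRoot (hp : p ≡ 1 [MOD 3]) {x : ℚ_[p]} (hx : ‖x - 1‖ < 1) :
    ∃ c : ℚ_[p], c ^ 3 = x ∧ ‖c - 1‖ < 1 := by
  let x' : ℤ_[p] := ⟨x, (norm_eq_one_of_norm_sub_one_lt hx).le⟩
  have h1 : ‖x' - 1‖ < 1 := hx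
  have h3 : ‖(2 + 1 : ℤ_[p])‖ = 1 := by rw [two_add_one_eq_three, norm_three_int hp]
  obtain ⟨z, hz, hz1, -⟩ := hensels_lemma (p := p) (R := ℤ_[p]) (F := X ^ 3 - C x') (a := 1) (by
    simpa [h3, norm_sub_rev] using h1)
  refine ⟨z, ?_, ?_⟩
  · have : z ^ 3 = x' := by simpa [sub_eq_zero] using hz
    simpa [x'] using congrArg (fun t : ℤ_[p] => (t : ℚ_[p])) this
  · have : ‖z - 1‖ < 1 := by simpa [h3] using hz1
    simpa [PadicInt.norm_def] using this

/-- The cofactor c² + cd + d² is congruent to 3, a unit, when c and d are congruent to 1; `key`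
bounds the difference from 3. -/
theorem norm_cube_sub_cube (hp : p ≡ 1 [MOD 3]) {c d : ℚ_[p]} (hc : ‖c - 1‖ < 1)
    (hd : ‖d - 1‖ < 1) : ‖c ^ 3 - d ^ 3‖ = ‖c - d‖ := by
  have hc' := norm_eq_one_of_norm_sub_one_lt hc
  have hd' := norm_eq_one_of_norm_sub_one_lt hd
  have key : ‖(c - 1) * (c + d + 1) + (d - 1) * (d + 2)‖ < 1 := by
    have h2 : ‖(2 : ℚ_[p])‖ ≤ 1 := by exact_mod_cast Padic.norm_int_le_one (p := p) 2
    have ha : ‖c + d + 1‖ ≤ 1 := norm_add_le (norm_add_le hc'.le hd'.le) norm_one.le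
    have hb : ‖d + 2‖ ≤ 1 := norm_add_le hd'.le h2
    refine norm_add_lt ?_ ?_
    · rw [norm_mul]; exact mul_lt_one_of_nonneg_of_lt_one_left (norm_nonneg _) hc ha
    · rw [norm_mul]; exact mul_lt_one_of_nonneg_of_lt_one_left (norm_nonneg _) hd hb
  have h3 := norm_three hp
  have : ‖c ^ 2 + c * d + d ^ 2‖ = 1 := by
    have := norm_add_eq_of_lt (key.trans_eq h3.symm)
    rw [h3] at this
    rw [← this]
    congr 1
    ring
  rw [show c ^ 3 - d ^ 3 = (c - d) * (c ^ 2 + c * d + d ^ 2) by ring, norm_mul, this, mul_one]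

/-- The cube root of `x` close to `1`, for `x` close to `1`. -/
def cubeRoot (x : ℚ_[p]) : ℚ_[p] :=
  open Classical in if h : ∃ c : ℚ_[p], c ^ 3 = x ∧ ‖c - 1‖ < 1 then h.choose else 0

theorem cubeRoot_spec (hp : p ≡ 1 [MOD 3]) {x : ℚ_[p]} (hx : ‖x - 1‖ < 1) :
    cubeRoot x ^ 3 = x ∧ ‖cubeRoot x - 1‖ < 1 := by
  have h := exists_cubeRoot hp hx
  rw [cubeRoot, dif_pos h]
  exact h.choose_spec

theorem norm_cubeRoot_sub (hp : p ≡ 1 [MOD 3]) {x y : ℚ_[p]} (hx : ‖x - 1‖ < 1)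
    (hy : ‖y - 1‖ < 1) : ‖cubeRoot x - cubeRoot y‖ = ‖x - y‖ := by
  rw [← norm_cube_sub_cube hp (cubeRoot_spec hp hx).2 (cubeRoot_spec hp hy).2,
    (cubeRoot_spec hp hx).1, (cubeRoot_spec hp hy).1]

theorem norm_cubeRoot_sub_one (hp : p ≡ 1 [MOD 3]) {x : ℚ_[p]} (hx : ‖x - 1‖ < 1) :
    ‖cubeRoot x - 1‖ = ‖x - 1‖ := by
  have h := norm_cube_sub_cube hp (cubeRoot_spec hp hx).2 (d := 1) (by simp)
  rw [← h, (cubeRoot_spec hp hx).1, one_pow]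

/-! ### Cube roots of unity -/

theorem exists_zmod_root (hp : p ≡ 1 [MOD 3]) : ∃ a : ZMod p, a ^ 2 + a + 1 = 0 := by
  have hdvd : 3 ∣ Nat.card (ZMod p)ˣ := by
    rw [Nat.card_eq_fintype_card, ZMod.card_units]
    exact (Nat.modEq_iff_dvd' (Fact.out : p.Prime).one_le).1 hp.symm
  obtain ⟨u, hu⟩ := exists_prime_orderOf_dvd_card' (G := (ZMod p)ˣ) 3 hdvd
  refine ⟨u, ?_⟩
  have hu1 : (u : ZMod p) - 1 ≠ 0 := by
    intro h
    have : u = 1 := Units.ext (sub_eq_zero.1 h)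
    rw [this, orderOf_one] at hu
    norm_num at hu
  have hu3 : (u : ZMod p) ^ 3 = 1 := by
    have := pow_orderOf_eq_one u
    rw [hu] at this
    rw [← Units.val_pow_eq_pow_val, this, Units.val_one]
  refine (mul_eq_zero.1 ?_).resolve_left hu1
  linear_combination hu3

theorem exists_omega (hp : p ≡ 1 [MOD 3]) : ∃ ω : ℚ_[p], ω ^ 2 + ω + 1 = 0 := by
  obtain ⟨a, ha⟩ := exists_zmod_root hp
  obtain ⟨n, rfl⟩ := ZMod.natCast_zmod_surjective a
  have hev : ‖(n : ℤ_[p]) ^ 2 + n + 1‖ < 1 := by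
    have h : ((n ^ 2 + n + 1 : ℕ) : ZMod p) = 0 := by push_cast; exact ha
    have h2 := (PadicInt.norm_int_lt_one_iff_dvd (p := p) ((n ^ 2 + n + 1 : ℕ) : ℤ)).2
      (Int.natCast_dvd_natCast.2 ((ZMod.natCast_eq_zero_iff _ _).1 h))
    push_cast at h2
    exact h2
  have h3 := norm_three_int hp
  -- The discriminant identity (2n + 1)² = 4(n² + n + 1) - 3 makes the derivative a unit.
  have hder : ‖2 * (n : ℤ_[p]) + 1‖ = 1 := by
    have h4 : ‖(2 * (n : ℤ_[p]) + 1) ^ 2‖ = 1 := by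
      have h5 : ‖4 * ((n : ℤ_[p]) ^ 2 + n + 1)‖ < ‖(-3 : ℤ_[p])‖ := by
        rw [norm_neg, h3, norm_mul]
        exact mul_lt_one_of_nonneg_of_lt_one_right (PadicInt.norm_le_one _) (norm_nonneg _) hev
      have h6 := PadicInt.norm_add_eq_max_of_ne h5.ne
      rw [max_eq_right h5.le, norm_neg, h3] at h6
      rw [← h6]
      congr 1
      ring
    rw [norm_pow] at h4
    exact (pow_eq_one_iff_of_nonneg (norm_nonneg _) two_ne_zero).1 h4
  obtain ⟨z, hz, -⟩ := hensels_lemma (p := p) (R := ℤ_[p]) (F := X ^ 2 + X + 1) (a := n) (by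
    simpa [one_add_one_eq_two, hder] using hev)
  refine ⟨z, ?_⟩
  have : z ^ 2 + z + 1 = 0 := by simpa using hz
  simpa using congrArg (fun t : ℤ_[p] => (t : ℚ_[p])) this

/-- `ζ` lists the three cube roots of unity, with `ζ 0 = 1`. -/
structure CubeRootsOfUnity (ζ : Fin 3 → ℚ_[p]) : Prop where
  zero : ζ 0 = 1
  pow : ∀ i, ζ i ^ 3 = 1
  norm_sub : ∀ i j, i ≠ j → ‖ζ i - ζ j‖ = 1
  exists_eq : ∀ z, z ^ 3 = 1 → ∃ i, z = ζ i

theorem norm_eq_one_of_cube_eq_one {z : ℚ_[p]} (h : z ^ 3 = 1) : ‖z‖ = 1 := by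
  have := congrArg norm h
  rw [norm_pow, norm_one] at this
  exact (pow_eq_one_iff_of_nonneg (norm_nonneg _) three_ne_zero).1 this

theorem exists_cubeRootsOfUnity (hp : p ≡ 1 [MOD 3]) :
    ∃ ζ : Fin 3 → ℚ_[p], CubeRootsOfUnity ζ := by
  obtain ⟨ω, hω⟩ := exists_omega hp
  have hω3 : ω ^ 3 = 1 := by linear_combination (ω - 1) * hω
  have hn := norm_eq_one_of_cube_eq_one hω3
  have h1 : ‖ω - 1‖ = 1 := by
    have hle : ‖ω - 1‖ ≤ 1 := by
      rw [sub_eq_add_neg]; exact norm_add_le hn.le (by simp)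
    have hle2 : ‖ω + 2‖ ≤ 1 := norm_add_le hn.le
      (by exact_mod_cast Padic.norm_int_le_one (p := p) 2)
    have : ‖ω - 1‖ * ‖ω + 2‖ = 1 := by
      rw [← norm_mul, show (ω - 1) * (ω + 2) = -3 by linear_combination hω, norm_neg,
        norm_three hp]
    nlinarith [norm_nonneg (ω - 1)]
  have h2 : ‖ω ^ 2 - 1‖ = 1 := by
    rw [show ω ^ 2 - 1 = ω ^ 2 * -(ω - 1) by linear_combination hω3, norm_mul, norm_neg, norm_pow,
      hn, h1]
    norm_num
  have h3 : ‖ω ^ 2 - ω‖ = 1 := by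
    rw [show ω ^ 2 - ω = ω * (ω - 1) by ring, norm_mul, hn, h1, one_mul]
  refine ⟨![1, ω, ω ^ 2], rfl, fun i => ?_, fun i j hij => ?_, fun z hz => ?_⟩
  · fin_cases i
    · simp
    · exact hω3
    · change (ω ^ 2) ^ 3 = 1
      rw [pow_right_comm, hω3, one_pow]
  · fin_cases i <;> fin_cases j <;> first
      | exact absurd rfl hij
      | simpa using h1
      | simpa using h2
      | simpa using h3
      | simpa [norm_sub_rev] using h1
      | simpa [norm_sub_rev] using h2
      | simpa [norm_sub_rev] using h3
  · have : (z - 1) * ((z - ω) * (z - ω ^ 2)) = 0 := by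
      linear_combination hz + (z ^ 2 * -1 + z * (1)) * hω + (z - 1) * hω3
    rcases mul_eq_zero.1 this with h | h
    · exact ⟨0, sub_eq_zero.1 h⟩
    · rcases mul_eq_zero.1 h with h | h
      · exact ⟨1, sub_eq_zero.1 h⟩
      · exact ⟨2, sub_eq_zero.1 h⟩

/-! ### The trap and its three inverse branches -/

/-- The range of parameters `0 < |θ - 1| < |q| < 1`. -/
structure Admissible (θ q : ℚ_[p]) : Prop where
  pos : 0 < ‖θ - 1‖
  lt : ‖θ - 1‖ < ‖q‖
  lt_one : ‖q‖ < 1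

/-- The closed ball of radius `|θ - 1|` around the pole. -/
def trap (θ q : ℚ_[p]) : Set ℚ_[p] := {x | ‖x - pole θ q‖ ≤ ‖θ - 1‖}

/-- The inverse branch of the map selected by a cube root of unity `z`. -/
def branch (θ q z x : ℚ_[p]) : ℚ_[p] :=
  pole θ q + (θ - 1) * (θ - 1 + q) / (θ - z * cubeRoot x)

/-- The absolute value of the denominator of the `i`-th branch. -/
def denNorm (q : ℚ_[p]) (i : Fin 3) : ℝ := if i = 0 then ‖q‖ else 1

variable {θ q : ℚ_[p]}

theorem Admissible.norm_add (h : Admissible θ q) : ‖θ - 1 + q‖ = ‖q‖ :=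
  norm_add_eq_of_lt h.lt

theorem Admissible.norm_q_pos (h : Admissible θ q) : 0 < ‖q‖ := h.pos.trans h.lt

theorem Admissible.sub_one_ne (h : Admissible θ q) : θ - 1 ≠ 0 := norm_pos_iff.1 h.pos

theorem Admissible.add_ne (h : Admissible θ q) : θ - 1 + q ≠ 0 :=
  norm_pos_iff.1 (h.norm_add ▸ h.norm_q_pos)

theorem Admissible.denNorm_pos (h : Admissible θ q) (i : Fin 3) : 0 < denNorm q i := by
  unfold denNorm; split_ifs
  exacts [h.norm_q_pos, one_pos]

theorem Admissible.le_denNorm (h : Admissible θ q) (i : Fin 3) : ‖q‖ ≤ denNorm q i := by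
  unfold denNorm; split_ifs
  exacts [le_rfl, h.lt_one.le]

theorem Admissible.norm_sub_one_of_mem_trap (h : Admissible θ q) {x : ℚ_[p]}
    (hx : x ∈ trap θ q) : ‖x - 1‖ = ‖q‖ := by
  have hlt : ‖x - pole θ q‖ < ‖-(θ - 1 + q)‖ := by
    rw [norm_neg, h.norm_add]; exact lt_of_le_of_lt hx h.lt
  have := norm_add_eq_of_lt hlt
  rw [norm_neg, h.norm_add] at this
  rw [← this, pole]
  congr 1
  ring

theorem Admissible.norm_sub_one_lt_of_mem_trap (h : Admissible θ q) {x : ℚ_[p]}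
    (hx : x ∈ trap θ q) : ‖x - 1‖ < 1 := by
  rw [h.norm_sub_one_of_mem_trap hx]; exact h.lt_one

theorem sub_pole_ne_zero {x : ℚ_[p]} (hx : x ∈ dom θ q) : x - pole θ q ≠ 0 := sub_ne_zero.2 hx

theorem base_eq {x : ℚ_[p]} (hx : x ∈ dom θ q) :
    (θ * x + q - 1) / (x + θ + q - 2) = θ - (θ - 1) * (θ - 1 + q) / (x - pole θ q) := by
  have h := sub_pole_ne_zero hx
  have h' : x + θ + q - 2 = x - pole θ q := by rw [pole]; ring
  rw [h', eq_sub_iff_add_eq, ← add_div, div_eq_iff h, pole]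
  ring

theorem map_eq {x : ℚ_[p]} (hx : x ∈ dom θ q) :
    map θ q 3 x = (θ - (θ - 1) * (θ - 1 + q) / (x - pole θ q)) ^ 3 := by
  rw [map, base_eq hx]

theorem Admissible.norm_pole (h : Admissible θ q) : ‖pole θ q‖ = 1 := by
  apply norm_eq_one_of_norm_sub_one_lt
  rw [show pole θ q - 1 = -(θ - 1 + q) by rw [pole]; ring, norm_neg, h.norm_add]
  exact h.lt_one

/-- Division by zero gives the pole the value 0, which is off the trap since the pole is a unit.
Hence orbits confined to the trap never meet the pole. -/
theorem Admissible.mem_dom_of_map_mem_trap (h : Admissible θ q) {x : ℚ_[p]}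
    (hx : map θ q 3 x ∈ trap θ q) : x ∈ dom θ q := by
  intro hxp
  have h0 : map θ q 3 x = 0 := by
    rw [map, hxp, show pole θ q + θ + q - 2 = 0 by rw [pole]; ring, div_zero]
    norm_num
  rw [h0, trap, Set.mem_ofPred_eq, zero_sub, norm_neg, h.norm_pole] at hx
  exact absurd (h.lt.trans h.lt_one) hx.not_gt

section Branches

variable (hp : p ≡ 1 [MOD 3]) (h : Admissible θ q) {ζ : Fin 3 → ℚ_[p]} (hζ : CubeRootsOfUnity ζ)

include hp h hζ

/-- In (θ - 1) - ζ(c - 1) + (1 - ζ), with c the cube root, the term c - 1 of norm |q| dominates if ζ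
= 1, and the unit 1 - ζ dominates otherwise. -/
theorem norm_den {x : ℚ_[p]} (hx : x ∈ trap θ q) (i : Fin 3) :
    ‖θ - ζ i * cubeRoot x‖ = denNorm q i := by
  have hc := norm_cubeRoot_sub_one hp (h.norm_sub_one_lt_of_mem_trap hx)
  rw [h.norm_sub_one_of_mem_trap hx] at hc
  by_cases hi : i = 0
  · rw [denNorm, if_pos hi, hi, hζ.zero]
    have hlt : ‖θ - 1‖ < ‖-(cubeRoot x - 1)‖ := by rw [norm_neg, hc]; exact h.lt
    rw [← hc, ← norm_neg (cubeRoot x - 1), ← norm_add_eq_of_lt hlt]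
    congr 1
    ring
  · rw [denNorm, if_neg hi]
    have h1 := hζ.norm_sub 0 i (Ne.symm hi)
    rw [hζ.zero] at h1
    have hlt : ‖(θ - 1) + -(ζ i * (cubeRoot x - 1))‖ < ‖1 - ζ i‖ := by
      rw [h1]
      refine norm_add_lt (h.lt.trans h.lt_one) ?_
      rw [norm_neg, norm_mul, norm_eq_one_of_cube_eq_one (hζ.pow i), one_mul, hc]
      exact h.lt_one
    rw [← h1, ← norm_add_eq_of_lt hlt]
    congr 1
    ring

theorem den_ne_zero {x : ℚ_[p]} (hx : x ∈ trap θ q) (i : Fin 3) :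
    θ - ζ i * cubeRoot x ≠ 0 :=
  norm_pos_iff.1 (by rw [norm_den hp h hζ hx]; exact h.denNorm_pos i)

theorem norm_branch_sub_pole {x : ℚ_[p]} (hx : x ∈ trap θ q) (i : Fin 3) :
    ‖branch θ q (ζ i) x - pole θ q‖ = ‖θ - 1‖ * ‖q‖ / denNorm q i := by
  rw [branch, add_sub_cancel_left, norm_div, norm_mul, h.norm_add, norm_den hp h hζ hx]

theorem branch_mem_trap {x : ℚ_[p]} (hx : x ∈ trap θ q) (i : Fin 3) :
    branch θ q (ζ i) x ∈ trap θ q := by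
  rw [trap, Set.mem_ofPred_eq, norm_branch_sub_pole hp h hζ hx, div_le_iff₀ (h.denNorm_pos i)]
  exact mul_le_mul_of_nonneg_left (h.le_denNorm i) (norm_nonneg _)

theorem branch_mem_dom {x : ℚ_[p]} (hx : x ∈ trap θ q) (i : Fin 3) :
    branch θ q (ζ i) x ∈ dom θ q := by
  refine sub_ne_zero.1 (norm_pos_iff.1 ?_)
  rw [norm_branch_sub_pole hp h hζ hx]
  exact div_pos (mul_pos h.pos h.norm_q_pos) (h.denNorm_pos i)

theorem norm_branch_sub {x y : ℚ_[p]} (hx : x ∈ trap θ q) (hy : y ∈ trap θ q) (i : Fin 3) :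
    ‖branch θ q (ζ i) x - branch θ q (ζ i) y‖ =
      ‖θ - 1‖ * ‖q‖ / denNorm q i ^ 2 * ‖x - y‖ := by
  have hdx := den_ne_zero hp h hζ hx i
  have hdy := den_ne_zero hp h hζ hy i
  have : branch θ q (ζ i) x - branch θ q (ζ i) y =
      (θ - 1) * (θ - 1 + q) / ((θ - ζ i * cubeRoot x) * (θ - ζ i * cubeRoot y)) *
        (ζ i * (cubeRoot x - cubeRoot y)) := by
    rw [branch, branch, add_sub_add_left_eq_sub, div_sub_div _ _ hdx hdy, div_mul_eq_mul_div]
    congr 1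
    ring
  rw [this, norm_mul, norm_div, norm_mul, norm_mul, norm_mul, h.norm_add,
    norm_eq_one_of_cube_eq_one (hζ.pow i), norm_den hp h hζ hx, norm_den hp h hζ hy, one_mul,
    norm_cubeRoot_sub hp (h.norm_sub_one_lt_of_mem_trap hx) (h.norm_sub_one_lt_of_mem_trap hy),
    sq]

theorem map_branch {x : ℚ_[p]} (hx : x ∈ trap θ q) (i : Fin 3) :
    map θ q 3 (branch θ q (ζ i) x) = x := by
  rw [map_eq (branch_mem_dom hp h hζ hx i), branch, add_sub_cancel_left, div_div_cancel₀
    (mul_ne_zero h.sub_one_ne h.add_ne), sub_sub_cancel, mul_pow, hζ.pow, one_mul,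
    (cubeRoot_spec hp (h.norm_sub_one_lt_of_mem_trap hx)).1]

theorem exists_eq_branch {x : ℚ_[p]} (hfx : map θ q 3 x ∈ trap θ q) :
    ∃ i, x = branch θ q (ζ i) (map θ q 3 x) := by
  have hd := h.mem_dom_of_map_mem_trap hfx
  obtain ⟨hc, hc1⟩ := cubeRoot_spec hp (h.norm_sub_one_lt_of_mem_trap hfx)
  have hc0 : cubeRoot (map θ q 3 x) ≠ 0 :=
    norm_pos_iff.1 (by rw [norm_eq_one_of_norm_sub_one_lt hc1]; exact one_pos)
  have hm := map_eq hd
  obtain ⟨i, hi⟩ := hζ.exists_eq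
    ((θ - (θ - 1) * (θ - 1 + q) / (x - pole θ q)) / cubeRoot (map θ q 3 x)) (by
      rw [div_pow, hc, ← hm, div_self]
      rw [← hc]
      exact pow_ne_zero 3 hc0)
  refine ⟨i, ?_⟩
  rw [branch, ← hi, div_mul_cancel₀ _ hc0, sub_sub_cancel,
    div_div_cancel₀ (mul_ne_zero h.sub_one_ne h.add_ne), add_sub_cancel]

/-- Equal values force equal denominators. Since both cube roots are congruent to 1, the two roots
of unity are then congruent, whereas distinct ones differ by a unit. -/
theorem branch_index_eq {x y : ℚ_[p]} (hx : x ∈ trap θ q) (hy : y ∈ trap θ q) {i j : Fin 3}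
    (hij : branch θ q (ζ i) x = branch θ q (ζ j) y) : i = j := by
  by_contra hne
  have hab := mul_ne_zero h.sub_one_ne h.add_ne
  have h1 : θ - ζ i * cubeRoot x = θ - ζ j * cubeRoot y := by
    have := add_left_cancel hij
    rw [div_eq_div_iff (den_ne_zero hp h hζ hx i) (den_ne_zero hp h hζ hy j)] at this
    exact (mul_left_cancel₀ hab this).symm
  have h2 := hζ.norm_sub i j hne
  have hx1 := norm_cubeRoot_sub_one hp (h.norm_sub_one_lt_of_mem_trap hx)
  have hy1 := norm_cubeRoot_sub_one hp (h.norm_sub_one_lt_of_mem_trap hy)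
  have h3 : ‖-(ζ i * (cubeRoot x - 1)) + ζ j * (cubeRoot y - 1)‖ < 1 := by
    refine norm_add_lt ?_ ?_
    · rw [norm_neg, norm_mul, norm_eq_one_of_cube_eq_one (hζ.pow i), one_mul, hx1]
      exact h.norm_sub_one_lt_of_mem_trap hx
    · rw [norm_mul, norm_eq_one_of_cube_eq_one (hζ.pow j), one_mul, hy1]
      exact h.norm_sub_one_lt_of_mem_trap hy
  rw [show -(ζ i * (cubeRoot x - 1)) + ζ j * (cubeRoot y - 1) = ζ i - ζ j by
    linear_combination h1, h2] at h3
  exact lt_irrefl _ h3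

end Branches

theorem isClosed_trap : IsClosed (trap θ q) :=
  isClosed_le (by fun_prop) continuous_const

theorem pole_mem_trap : pole θ q ∈ trap θ q := by
  simp [trap]

theorem isBounded_trap : Bornology.IsBounded (trap θ q) :=
  Metric.isBounded_closedBall.subset fun x hx => by
    rw [Metric.mem_closedBall, dist_eq_norm]
    exact hx

theorem contracting_branch (hp : p ≡ 1 [MOD 3]) (h : Admissible θ q) {ζ : Fin 3 → ℚ_[p]}
    (hζ : CubeRootsOfUnity ζ) (i : Fin 3) :
    ContractingWith (‖θ - 1‖₊ / ‖q‖₊) fun x : trap θ q =>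
      (⟨branch θ q (ζ i) x, branch_mem_trap hp h hζ x.2 i⟩ : trap θ q) := by
  refine ⟨?_, LipschitzWith.of_dist_le_mul fun x y => ?_⟩
  · rw [← NNReal.coe_lt_coe]
    push_cast
    exact (div_lt_one h.norm_q_pos).2 h.lt
  · rw [Subtype.dist_eq, Subtype.dist_eq, dist_eq_norm, dist_eq_norm,
      norm_branch_sub hp h hζ x.2 y.2]
    refine mul_le_mul_of_nonneg_right ?_ (norm_nonneg _)
    push_cast
    -- The common ratio is that of the weakest branch, i = 0, whose denominator has norm |q|.
    rw [div_le_div_iff₀ (pow_pos (h.denNorm_pos i) 2) h.norm_q_pos, mul_assoc, ← sq]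
    exact mul_le_mul_of_nonneg_left
      (pow_le_pow_left₀ (norm_nonneg _) (h.le_denNorm i) 2) (norm_nonneg _)

theorem conjugateToFullShift_trap (hp : p ≡ 1 [MOD 3]) (h : Admissible θ q) :
    ConjugateToFullShift (map θ q 3) {x | ∀ n, (map θ q 3)^[n] x ∈ trap θ q} 3 := by
  obtain ⟨ζ, hζ⟩ := exists_cubeRootsOfUnity hp
  have : CompleteSpace (trap θ q) := isClosed_trap.completeSpace_coe
  have : Nonempty (trap θ q) := ⟨⟨_, pole_mem_trap⟩⟩
  refine conjugateToFullShift_of_contractions _ _ isBounded_trap _ _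
    (contracting_branch hp h hζ) (fun i x => map_branch hp h hζ x.2 i)
    (fun i j x y hxy => branch_index_eq hp h hζ x.2 y.2 (congrArg Subtype.val hxy))
    fun x hx => ?_
  obtain ⟨i, hi⟩ := exists_eq_branch hp h hζ hx
  exact ⟨i, Subtype.ext hi⟩

theorem exists_branch_fixedPoint (hp : p ≡ 1 [MOD 3]) (h : Admissible θ q) {ζ : Fin 3 → ℚ_[p]}
    (hζ : CubeRootsOfUnity ζ) (i : Fin 3) : ∃ x ∈ trap θ q, branch θ q (ζ i) x = x := by
  have : CompleteSpace (trap θ q) := isClosed_trap.completeSpace_coe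
  have : Nonempty (trap θ q) := ⟨⟨_, pole_mem_trap⟩⟩
  have hc := contracting_branch hp h hζ i
  exact ⟨_, (hc.fixedPoint).2, congrArg Subtype.val hc.fixedPoint_isFixedPt⟩

/-! ### Escape from the trap and the basin of 1 -/

theorem mem_dom_of_notMem_trap {x : ℚ_[p]} (hx : x ∉ trap θ q) : x ∈ dom θ q := by
  rintro rfl
  exact hx pole_mem_trap

/-- The bound is the displacement from 1 of the Möbius factor, which fixes 1; cubing does not expand
distances to 1 on units. -/
theorem norm_map_sub_one_le {x : ℚ_[p]} (hx : x ∈ dom θ q)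
    (hlt : ‖(θ - 1) * (x - 1) / (x - pole θ q)‖ < 1) :
    ‖map θ q 3 x - 1‖ ≤ ‖(θ - 1) * (x - 1) / (x - pole θ q)‖ := by
  set g := (θ * x + q - 1) / (x + θ + q - 2) with hg
  have hg1 : g - 1 = (θ - 1) * (x - 1) / (x - pole θ q) := by
    have hw := sub_pole_ne_zero hx
    rw [hg, base_eq hx, sub_right_comm, sub_eq_iff_eq_add, ← add_div, eq_div_iff hw, pole]
    ring
  rw [← hg1] at hlt ⊢
  have hgn := norm_eq_one_of_norm_sub_one_lt hlt
  rw [map, ← hg, show g ^ 3 - 1 = (g - 1) * (g ^ 2 + g + 1) by ring, norm_mul]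
  refine mul_le_of_le_one_right (norm_nonneg _)
    (norm_add_le (norm_add_le ?_ hgn.le) norm_one.le)
  rw [norm_pow, hgn, one_pow]

theorem Admissible.norm_sub_pole_of_mem_setA (h : Admissible θ q) {x : ℚ_[p]} (hx : x ∈ setA q) :
    ‖x - pole θ q‖ = ‖q‖ := by
  have hx' : ‖x - 1‖ < ‖θ - 1 + q‖ := h.norm_add.symm ▸ hx
  rw [← h.norm_add, ← norm_add_eq_of_lt hx', pole]
  congr 1
  ring

theorem Admissible.setA_subset_dom (h : Admissible θ q) : setA q ⊆ dom θ q := fun x hx => by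
  refine sub_ne_zero.1 (norm_pos_iff.1 ?_)
  rw [h.norm_sub_pole_of_mem_setA hx]
  exact h.norm_q_pos

theorem Admissible.norm_map_sub_one_le_of_mem_setA (h : Admissible θ q) {x : ℚ_[p]}
    (hx : x ∈ setA q) : ‖map θ q 3 x - 1‖ ≤ ‖θ - 1‖ / ‖q‖ * ‖x - 1‖ := by
  have hn : ‖(θ - 1) * (x - 1) / (x - pole θ q)‖ = ‖θ - 1‖ / ‖q‖ * ‖x - 1‖ := by
    rw [norm_div, norm_mul, h.norm_sub_pole_of_mem_setA hx, div_mul_eq_mul_div]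
  rw [← hn]
  refine norm_map_sub_one_le (h.setA_subset_dom hx) ?_
  rw [hn]
  have h1 := (div_lt_one h.norm_q_pos).2 h.lt
  have h2 : ‖x - 1‖ < 1 := lt_trans hx h.lt_one
  exact mul_lt_one_of_nonneg_of_lt_one_left (by positivity) h1 h2.le

theorem Admissible.setA_subset_basin (h : Admissible θ q) : setA q ⊆ basin θ q 3 1 := by
  intro x hx
  have h1 := (div_lt_one h.norm_q_pos).2 h.lt
  have key : ∀ n, (map θ q 3)^[n] x ∈ setA q ∧
      ‖(map θ q 3)^[n] x - 1‖ ≤ (‖θ - 1‖ / ‖q‖) ^ n * ‖x - 1‖ := by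
    intro n
    induction n with
    | zero => exact ⟨hx, by simp⟩
    | succ n ih =>
      rw [Function.iterate_succ_apply']
      have hle := h.norm_map_sub_one_le_of_mem_setA ih.1
      refine ⟨(hle.trans (mul_le_of_le_one_left (norm_nonneg _) h1.le)).trans_lt ih.1, ?_⟩
      rw [pow_succ', mul_assoc]
      exact hle.trans (mul_le_mul_of_nonneg_left ih.2 (by positivity))
  refine ⟨fun n => h.setA_subset_dom (key n).1, ?_⟩
  rw [tendsto_iff_norm_sub_tendsto_zero]
  refine squeeze_zero (fun _ => norm_nonneg _) (fun n => (key n).2) ?_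
  simpa using (tendsto_pow_atTop_nhds_zero_of_lt_one (by positivity) h1).mul_const ‖x - 1‖

theorem mem_basin_of_iterate {x a : ℚ_[p]} {k n : ℕ}
    (hd : ∀ i < n, (map θ q k)^[i] x ∈ dom θ q) (hx : (map θ q k)^[n] x ∈ basin θ q k a) :
    x ∈ basin θ q k a := by
  have hadd : ∀ m, (map θ q k)^[m] ((map θ q k)^[n] x) = (map θ q k)^[m + n] x := fun m =>
    (Function.iterate_add_apply _ m n x).symm
  refine ⟨fun m => ?_, ?_⟩
  · rcases lt_or_ge m n with hm | hm
    · exact hd m hm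
    · have := hx.1 (m - n)
      rwa [hadd, Nat.sub_add_cancel hm] at this
  · have := hx.2
    simp only [hadd] at this
    exact (tendsto_add_atTop_iff_nat n).1 this

theorem Admissible.map_mem_setA_of_notMem_trap (h : Admissible θ q) {x : ℚ_[p]}
    (hx : x ∉ trap θ q) : map θ q 3 x ∈ setA q := by
  have hx' : ‖θ - 1‖ < ‖x - pole θ q‖ := not_le.1 hx
  have hpos := h.pos.trans hx'
  have hn : ‖(θ - 1) * (x - 1) / (x - pole θ q)‖ < ‖q‖ := by
    rw [norm_div, norm_mul, div_lt_iff₀ hpos]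
    have hle : ‖x - 1‖ ≤ max ‖x - pole θ q‖ ‖q‖ := by
      have := Padic.nonarchimedean (x - pole θ q) (-(θ - 1 + q))
      rw [norm_neg, h.norm_add] at this
      convert this using 2
      rw [pole]
      ring
    rcases le_max_iff.1 hle with hle | hle
    · calc ‖θ - 1‖ * ‖x - 1‖ ≤ ‖θ - 1‖ * ‖x - pole θ q‖ := by gcongr
        _ < ‖q‖ * ‖x - pole θ q‖ := mul_lt_mul_of_pos_right h.lt hpos
    · calc ‖θ - 1‖ * ‖x - 1‖ ≤ ‖θ - 1‖ * ‖q‖ := by gcongr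
        _ < ‖x - pole θ q‖ * ‖q‖ := mul_lt_mul_of_pos_right hx' h.norm_q_pos
        _ = ‖q‖ * ‖x - pole θ q‖ := mul_comm _ _
  exact (norm_map_sub_one_le (mem_dom_of_notMem_trap hx) (hn.trans h.lt_one)).trans_lt hn

theorem Admissible.mem_basin_of_notMem_trap (h : Admissible θ q) {x : ℚ_[p]}
    (hx : x ∉ trap θ q) : x ∈ basin θ q 3 1 := by
  refine mem_basin_of_iterate (n := 1) (fun i hi => ?_)
    (h.setA_subset_basin (h.map_mem_setA_of_notMem_trap hx))
  rw [Nat.lt_one_iff.1 hi]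
  exact mem_dom_of_notMem_trap hx

theorem Admissible.basin_eq_iUnion (h : Admissible θ q) :
    basin θ q 3 1 = ⋃ n : ℕ, preimageIter θ q 3 n (setA q) := by
  ext x
  rw [Set.mem_iUnion]
  constructor
  · rintro ⟨hd, hlim⟩
    have hnhds : setA q ∈ 𝓝 (1 : ℚ_[p]) := by
      refine Filter.mem_of_superset (Metric.ball_mem_nhds 1 h.norm_q_pos) fun y hy => ?_
      rwa [Metric.mem_ball, dist_eq_norm] at hy
    obtain ⟨n, hn⟩ := (hlim.eventually hnhds).exists
    exact ⟨n, fun i _ => hd i, hn⟩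
  · rintro ⟨n, hd, hn⟩
    exact mem_basin_of_iterate hd (h.setA_subset_basin hn)

theorem Admissible.univ_eq_union (h : Admissible θ q) :
    Set.univ = basin θ q 3 1 ∪ {x | ∀ n, (map θ q 3)^[n] x ∈ trap θ q} ∪
      ⋃ n : ℕ, preimageIter θ q 3 n {pole θ q} := by
  refine (Set.eq_univ_of_forall fun x => ?_).symm
  by_cases hd : ∀ n, (map θ q 3)^[n] x ∈ dom θ q
  · refine Or.inl ?_
    by_cases hJ : ∀ n, (map θ q 3)^[n] x ∈ trap θ q
    · exact Or.inr hJ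
    · obtain ⟨n, hn⟩ := not_forall.1 hJ
      exact Or.inl (mem_basin_of_iterate (fun i _ => hd i) (h.mem_basin_of_notMem_trap hn))
  · classical
    have hex := not_forall.1 hd
    -- The first time outside the domain is the time of arrival at the pole.
    refine Or.inr (Set.mem_iUnion.2 ⟨Nat.find hex, fun i hi => ?_, ?_⟩)
    · exact not_not.1 (Nat.find_min hex hi)
    · exact not_not.1 (Nat.find_spec hex)

/-! ### Fixed points, the cubic and multipliers -/

theorem pt_eq (y : ℚ_[p]) : pt θ q y = pole θ q + (θ - 1) * y := by
  rw [pt, pole]; ring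

theorem pt_sub_pole (y : ℚ_[p]) : pt θ q y - pole θ q = (θ - 1) * y := by
  rw [pt_eq, add_sub_cancel_left]

theorem eval_cubic (y : ℚ_[p]) : (cubic θ q).eval y =
    y ^ 3 - (1 + θ + θ ^ 2) * y ^ 2 - (2 * θ + 1) * (1 - θ - q) * y - (1 - θ - q) ^ 2 := by
  simp [cubic]

theorem natDegree_cubic : (cubic θ q).natDegree = 3 := by
  unfold cubic
  compute_degree!

theorem cubic_ne_zero : cubic θ q ≠ 0 := by
  intro h
  have := natDegree_cubic (θ := θ) (q := q)
  rw [h, natDegree_zero] at this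
  norm_num at this

theorem Admissible.pt_mem_dom_iff (h : Admissible θ q) {y : ℚ_[p]} :
    pt θ q y ∈ dom θ q ↔ y ≠ 0 := by
  rw [← mul_ne_zero_iff_left h.sub_one_ne, ← pt_sub_pole (q := q), sub_ne_zero]
  rfl

/-- In the coordinate y the fixed-point equation is a quartic, and the linear factor θ - 1 + q - (θ
- 1)y, belonging to the fixed point 1, splits off the cubic. -/
theorem Admissible.map_pt_eq_iff (h : Admissible θ q) {y : ℚ_[p]} (hy : y ≠ 0) :
    map θ q 3 (pt θ q y) = pt θ q y ↔ pt θ q y = 1 ∨ (cubic θ q).eval y = 0 := by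
  have ha := h.sub_one_ne
  have h1 : pt θ q y = 1 ↔ θ - 1 + q - (θ - 1) * y = 0 := by
    rw [pt_eq, pole]
    constructor <;> intro h' <;> linear_combination -h'
  have hb : θ - (θ - 1) * (θ - 1 + q) / ((θ - 1) * y) = (θ * y - (θ - 1 + q)) / y := by
    rw [mul_div_mul_left _ _ ha, sub_div, mul_div_cancel_right₀ _ hy]
  rw [h1, ← mul_eq_zero, map_eq (h.pt_mem_dom_iff.2 hy), pt_sub_pole, hb, div_pow,
    div_eq_iff (pow_ne_zero 3 hy), pt_eq, pole, eval_cubic, ← sub_eq_zero]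
  ring_nf

theorem AreRoots.eval_eq_zero_iff {y₁ y₂ y₃ : ℚ_[p]} (hy : AreRoots θ q y₁ y₂ y₃) {y : ℚ_[p]} :
    (cubic θ q).eval y = 0 ↔ y = y₁ ∨ y = y₂ ∨ y = y₃ := by
  have : y ∈ (cubic θ q).roots ↔ (cubic θ q).eval y = 0 := by
    rw [mem_roots cubic_ne_zero, IsRoot.def]
  rw [← this, hy.roots_eq]
  simp

theorem Admissible.norm_one_sub (h : Admissible θ q) : ‖1 - θ - q‖ = ‖q‖ := by
  rw [← h.norm_add, ← norm_neg]
  congr 1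
  ring

theorem Admissible.norm_root (h : Admissible θ q) {y₁ y₂ y₃ : ℚ_[p]}
    (hy : AreRoots θ q y₁ y₂ y₃) {y : ℚ_[p]} (hr : y = y₁ ∨ y = y₂ ∨ y = y₃) :
    0 < ‖y‖ ∧ ‖y‖ ≤ 1 := by
  rcases hr with rfl | rfl | rfl
  · rw [hy.norm_one]; exact ⟨one_pos, le_rfl⟩
  · rw [hy.norm_two, h.norm_one_sub]; exact ⟨h.norm_q_pos, h.lt_one.le⟩
  · rw [hy.norm_three, h.norm_one_sub]; exact ⟨h.norm_q_pos, h.lt_one.le⟩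

theorem Admissible.one_mem_dom (h : Admissible θ q) : (1 : ℚ_[p]) ∈ dom θ q := by
  apply h.setA_subset_dom
  simpa [setA] using norm_pos_iff.1 h.norm_q_pos

theorem Admissible.map_one_eq (h : Admissible θ q) : map θ q 3 1 = 1 := by
  rw [map, show θ * 1 + q - 1 = θ - 1 + q by ring, show 1 + θ + q - 2 = θ - 1 + q by ring,
    div_self h.add_ne, one_pow]

theorem Admissible.fixedPoints_eq (h : Admissible θ q) {y₁ y₂ y₃ : ℚ_[p]}
    (hy : AreRoots θ q y₁ y₂ y₃) :
    fixedPoints θ q 3 = {1, pt θ q y₁, pt θ q y₂, pt θ q y₃} := by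
  have hroot : ∀ y, y = y₁ ∨ y = y₂ ∨ y = y₃ → pt θ q y ∈ fixedPoints θ q 3 := fun y hr => by
    have hy0 := norm_pos_iff.1 (h.norm_root hy hr).1
    exact ⟨h.pt_mem_dom_iff.2 hy0, (h.map_pt_eq_iff hy0).2 (Or.inr (hy.eval_eq_zero_iff.2 hr))⟩
  ext x
  simp only [Set.mem_insert_iff, Set.mem_singleton_iff]
  constructor
  · rintro ⟨hd, hx⟩
    obtain ⟨y, rfl⟩ : ∃ y, x = pt θ q y := ⟨(x - pole θ q) / (θ - 1), by
      rw [pt_eq, mul_div_cancel₀ _ h.sub_one_ne, add_sub_cancel]⟩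
    rcases (h.map_pt_eq_iff (h.pt_mem_dom_iff.1 hd)).1 hx with h1 | h1
    · exact Or.inl h1
    · rcases hy.eval_eq_zero_iff.1 h1 with rfl | rfl | rfl <;> simp
  · rintro (rfl | rfl | rfl | rfl)
    · exact ⟨h.one_mem_dom, h.map_one_eq⟩
    all_goals exact hroot _ (by simp)

theorem hasDerivAt_map {x : ℚ_[p]} (hx : x ∈ dom θ q) :
    HasDerivAt (map θ q 3) (3 * ((θ * x + q - 1) / (x + θ + q - 2)) ^ 2 *
      ((θ - 1) * (θ - 1 + q) / (x - pole θ q) ^ 2)) x := by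
  have hD : x + θ + q - 2 = x - pole θ q := by rw [pole]; ring
  have hD0 : x + θ + q - 2 ≠ 0 := hD ▸ sub_pole_ne_zero hx
  have hN : HasDerivAt (fun x => θ * x + q - 1) θ x := by
    simpa using (((hasDerivAt_id x).const_mul θ).add_const q).sub_const 1
  have hDd : HasDerivAt (fun x => x + θ + q - 2) 1 x :=
    (((hasDerivAt_id x).add_const θ).add_const q).sub_const 2
  refine HasDerivAt.congr_deriv (f := map θ q 3) ((hN.fun_div hDd hD0).fun_pow 3) ?_
  rw [← hD, show θ * (x + θ + q - 2) - (θ * x + q - 1) * 1 = (θ - 1) * (θ - 1 + q) by ring]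
  norm_num

/-- The Möbius factor is a unit because its cube is x, so only the distance to the pole matters: |q|
at the point 1, at most |θ - 1| on the trap. -/
theorem norm_multiplier (hp : p ≡ 1 [MOD 3]) (h : Admissible θ q) {x : ℚ_[p]}
    (hx : map θ q 3 x = x) (hn : ‖x‖ = 1) :
    ‖3 * ((θ * x + q - 1) / (x + θ + q - 2)) ^ 2 *
      ((θ - 1) * (θ - 1 + q) / (x - pole θ q) ^ 2)‖ = ‖θ - 1‖ * ‖q‖ / ‖x - pole θ q‖ ^ 2 := by
  have hg : ‖(θ * x + q - 1) / (x + θ + q - 2)‖ = 1 := by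
    have h1 : ‖map θ q 3 x‖ = 1 := by rw [hx, hn]
    rw [map, norm_pow] at h1
    exact (pow_eq_one_iff_of_nonneg (norm_nonneg _) three_ne_zero).1 h1
  rw [norm_mul, norm_mul, norm_pow, hg, norm_three hp, norm_div, norm_mul, norm_pow, h.norm_add]
  ring

theorem isAttracting_one (hp : p ≡ 1 [MOD 3]) (h : Admissible θ q) : IsAttracting θ q 3 1 := by
  refine ⟨⟨h.one_mem_dom, h.map_one_eq⟩, _, hasDerivAt_map h.one_mem_dom, ?_⟩
  rw [norm_multiplier hp h h.map_one_eq norm_one,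
    h.norm_sub_pole_of_mem_setA (by simpa [setA] using norm_pos_iff.1 h.norm_q_pos),
    div_lt_one (pow_pos h.norm_q_pos 2), sq]
  exact mul_lt_mul_of_pos_right h.lt h.norm_q_pos

theorem isRepelling_of_mem_trap (hp : p ≡ 1 [MOD 3]) (h : Admissible θ q) {x : ℚ_[p]}
    (hx : x ∈ fixedPoints θ q 3) (hxt : x ∈ trap θ q) : IsRepelling θ q 3 x := by
  refine ⟨hx, _, hasDerivAt_map hx.1, ?_⟩
  rw [norm_multiplier hp h hx.2
    (norm_eq_one_of_norm_sub_one_lt (h.norm_sub_one_lt_of_mem_trap hxt)),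
    one_lt_div (pow_pos (norm_pos_iff.2 (sub_pole_ne_zero hx.1)) 2)]
  calc ‖x - pole θ q‖ ^ 2 ≤ ‖θ - 1‖ ^ 2 := pow_le_pow_left₀ (norm_nonneg _) hxt 2
    _ < ‖θ - 1‖ * ‖q‖ := by rw [sq]; exact mul_lt_mul_of_pos_left h.lt h.pos

theorem Admissible.pt_mem_trap (h : Admissible θ q) {y₁ y₂ y₃ : ℚ_[p]}
    (hy : AreRoots θ q y₁ y₂ y₃) {y : ℚ_[p]} (hr : y = y₁ ∨ y = y₂ ∨ y = y₃) :
    pt θ q y ∈ trap θ q := by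
  rw [trap, Set.mem_ofPred_eq, pt_sub_pole, norm_mul]
  exact mul_le_of_le_one_right (norm_nonneg _) (h.norm_root hy hr).2

/-! ### Matching roots, branches and the sets C -/

/-- The roots of the cubic are the rescaled fixed points of the inverse branches. -/
theorem exists_areRoots (hp : p ≡ 1 [MOD 3]) (h : Admissible θ q) {ζ : Fin 3 → ℚ_[p]}
    (hζ : CubeRootsOfUnity ζ) : ∃ η : Fin 3 → ℚ_[p], AreRoots θ q (η 0) (η 1) (η 2) ∧
      Function.Injective η ∧ ∀ i, pt θ q (η i) ∈ trap θ q ∧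
        branch θ q (ζ i) (pt θ q (η i)) = pt θ q (η i) := by
  choose ξ hξ hfix using exists_branch_fixedPoint hp h hζ
  have ha := h.sub_one_ne
  have hpt : ∀ i, pt θ q ((ξ i - pole θ q) / (θ - 1)) = ξ i := fun i => by
    rw [pt_eq, mul_div_cancel₀ _ ha, add_sub_cancel]
  let η : Fin 3 → ℚ_[p] := fun i => (ξ i - pole θ q) / (θ - 1)
  have hinj : Function.Injective η := fun i j hij => by
    have h1 : ξ i = ξ j := by rw [← hpt i, ← hpt j]; exact congrArg _ hij
    exact branch_index_eq hp h hζ (hξ i) (hξ j) (by rw [hfix, hfix, h1])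
  have hnorm : ∀ i, ‖η i‖ = ‖q‖ / denNorm q i := fun i => by
    have h1 := norm_branch_sub_pole hp h hζ (hξ i) i
    rw [hfix] at h1
    rw [norm_div, h1, mul_div_assoc, mul_div_cancel_left₀ _ h.pos.ne']
  have hne : ∀ i, η i ≠ 0 := fun i =>
    norm_pos_iff.1 (by rw [hnorm]; exact div_pos h.norm_q_pos (h.denNorm_pos i))
  have hroot : ∀ i, (cubic θ q).eval (η i) = 0 := fun i => by
    refine ((h.map_pt_eq_iff (hne i)).1 ?_).resolve_left ?_
    · have h1 := map_branch hp h hζ (hξ i) i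
      rw [hfix] at h1
      rw [hpt, h1]
    · rw [hpt]
      intro h1
      have h2 := h.norm_sub_one_of_mem_trap (hξ i)
      rw [h1, sub_self, norm_zero] at h2
      exact h.norm_q_pos.ne h2
  refine ⟨η, ⟨?_, ?_, ?_, ?_⟩, hinj, fun i => ?_⟩
  · symm
    -- Three distinct roots exhaust a polynomial of degree three.
    refine Multiset.eq_of_le_of_card_le ((Multiset.le_iff_subset ?_).2 fun y hy => ?_) ?_
    · simp [hinj.eq_iff]
    · rw [mem_roots cubic_ne_zero, IsRoot.def]
      simp only [Multiset.insert_eq_cons, Multiset.mem_cons, Multiset.mem_singleton] at hy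
      rcases hy with rfl | rfl | rfl <;> exact hroot _
    · simpa [natDegree_cubic] using (cubic θ q).card_roots'
  · rw [hnorm, denNorm, if_pos rfl, div_self h.norm_q_pos.ne']
  · rw [hnorm, h.norm_one_sub, denNorm, if_neg (by decide), div_one]
  · rw [hnorm, h.norm_one_sub, denNorm, if_neg (by decide), div_one]
  · rw [hpt]
    exact ⟨hξ i, hfix i⟩

/-- Two points of the trap are at distance at most |θ - 1|, less than the norm of the denominator;
after contraction this is less than the common distance of the images to the pole. -/
theorem branch_mem_setC (hp : p ≡ 1 [MOD 3]) (h : Admissible θ q) {ζ : Fin 3 → ℚ_[p]}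
    (hζ : CubeRootsOfUnity ζ) {x c : ℚ_[p]} (hx : x ∈ trap θ q) (hc : c ∈ trap θ q) {i : Fin 3}
    (hfix : branch θ q (ζ i) c = c) :
    branch θ q (ζ i) x ∈ setC θ q c (‖θ - 1‖ * ‖q‖ / denNorm q i) := by
  have hr := norm_branch_sub_pole hp h hζ hx i
  refine ⟨?_, hr⟩
  rw [hr]
  nth_rewrite 1 [← hfix]
  have hd := h.denNorm_pos i
  have hxc : ‖x - c‖ ≤ ‖θ - 1‖ := by
    rw [← sub_sub_sub_cancel_right x c (pole θ q), sub_eq_add_neg]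
    exact norm_add_le hx (by rw [norm_neg]; exact hc)
  have hlt : ‖x - c‖ < denNorm q i := hxc.trans_lt (h.lt.trans_le (h.le_denNorm i))
  rw [norm_branch_sub hp h hζ hx hc, div_mul_eq_mul_div, div_lt_div_iff₀ (pow_pos hd 2) hd, sq,
    mul_assoc]
  exact mul_lt_mul_of_pos_left (mul_lt_mul_of_pos_right hlt hd) (mul_pos h.pos h.norm_q_pos)

theorem unionC_swap (y₁ y₂ y₃ : ℚ_[p]) : unionC θ q y₁ y₃ y₂ = unionC θ q y₁ y₂ y₃ :=
  Set.union_right_comm _ _ _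

/-- The norm singles out the unit root, so an arbitrary numbering differs from the one by branches
at most in the order of the other two. -/
theorem AreRoots.eq_or_swap (h : Admissible θ q) {y₁ y₂ y₃ η₁ η₂ η₃ : ℚ_[p]}
    (hy : AreRoots θ q y₁ y₂ y₃) (hη : AreRoots θ q η₁ η₂ η₃) :
    y₁ = η₁ ∧ (y₂ = η₂ ∧ y₃ = η₃ ∨ y₂ = η₃ ∧ y₃ = η₂) := by
  have hne : (1 : ℝ) ≠ ‖1 - θ - q‖ := by rw [h.norm_one_sub]; exact h.lt_one.ne'
  have h1 : y₁ = η₁ := by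
    rcases hη.eval_eq_zero_iff.1 (hy.eval_eq_zero_iff.2 (Or.inl rfl)) with h1 | h1 | h1
    · exact h1
    · exact absurd (hy.norm_one.symm.trans (h1 ▸ hη.norm_two)) hne
    · exact absurd (hy.norm_one.symm.trans (h1 ▸ hη.norm_three)) hne
  subst h1
  have hm := hy.roots_eq.symm.trans hη.roots_eq
  simp only [Multiset.insert_eq_cons, Multiset.cons_inj_right] at hm
  refine ⟨rfl, ?_⟩
  have h2 : y₂ = η₂ ∨ y₂ = η₃ := by
    have : y₂ ∈ η₂ ::ₘ {η₃} := hm ▸ Multiset.mem_cons_self _ _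
    simpa using this
  rcases h2 with rfl | rfl
  · exact Or.inl ⟨rfl, by simpa using hm⟩
  · refine Or.inr ⟨rfl, ?_⟩
    have hm' := hm.trans (Multiset.cons_swap η₂ y₂ 0)
    exact Multiset.singleton_inj.1 ((Multiset.cons_inj_right y₂).1 hm')

theorem mem_unionC_of_map_mem_trap (hp : p ≡ 1 [MOD 3]) (h : Admissible θ q) {y₁ y₂ y₃ x : ℚ_[p]}
    (hy : AreRoots θ q y₁ y₂ y₃) (hx : map θ q 3 x ∈ trap θ q) : x ∈ unionC θ q y₁ y₂ y₃ := by
  obtain ⟨ζ, hζ⟩ := exists_cubeRootsOfUnity hp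
  obtain ⟨η, hη, -, hfix⟩ := exists_areRoots hp h hζ
  have hU : unionC θ q y₁ y₂ y₃ = unionC θ q (η 0) (η 1) (η 2) := by
    obtain ⟨rfl, ⟨rfl, rfl⟩ | ⟨rfl, rfl⟩⟩ := hy.eq_or_swap h hη
    · rfl
    · exact unionC_swap _ _ _
  obtain ⟨i, hi⟩ := exists_eq_branch hp h hζ hx
  have hmem := branch_mem_setC hp h hζ hx (hfix i).1 (hfix i).2
  rw [← hi] at hmem
  rw [hU]
  fin_cases i
  · refine Or.inl (Or.inl ?_)
    simpa [denNorm, h.norm_q_pos.ne'] using hmem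
  · refine Or.inl (Or.inr ?_)
    simpa [denNorm, mul_comm] using hmem
  · refine Or.inr ?_
    simpa [denNorm, mul_comm] using hmem

theorem ncard_fixedPoints (hp : p ≡ 1 [MOD 3]) (h : Admissible θ q) :
    (fixedPoints θ q 3).ncard = 4 := by
  obtain ⟨ζ, hζ⟩ := exists_cubeRootsOfUnity hp
  obtain ⟨η, hη, hinj, hfix⟩ := exists_areRoots hp h hζ
  have h1 : ∀ i, (1 : ℚ_[p]) ≠ pt θ q (η i) := fun i h1 => by
    have h2 := h.norm_sub_one_of_mem_trap (hfix i).1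
    rw [← h1, sub_self, norm_zero] at h2
    exact h.norm_q_pos.ne h2
  have h2 : ∀ i j, pt θ q (η i) = pt θ q (η j) ↔ i = j := fun i j => by
    rw [pt_eq, pt_eq, add_right_inj, mul_right_inj' h.sub_one_ne, hinj.eq_iff]
  rw [h.fixedPoints_eq hη, Set.ncard_insert_of_notMem (by simp [h1]),
    Set.ncard_insert_of_notMem (by simp [h2]), Set.ncard_pair (by simp [h2])]

end PottsBethe

end

/-! ### Assembly -/

theorem mainTheorem1 (p : ℕ) [Fact p.Prime] (hp : p ≡ 1 [MOD 3]) (θ q : ℚ_[p])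
    (hθ : 0 < ‖θ - 1‖) (hθq : ‖θ - 1‖ < ‖q‖) (hq : ‖q‖ < 1) :
    (∃ y₁ y₂ y₃ : ℚ_[p], PottsBethe.AreRoots θ q y₁ y₂ y₃) ∧
    ∀ y₁ y₂ y₃ : ℚ_[p], PottsBethe.AreRoots θ q y₁ y₂ y₃ →
      (PottsBethe.fixedPoints θ q 3 =
          {1, PottsBethe.pt θ q y₁, PottsBethe.pt θ q y₂, PottsBethe.pt θ q y₃} ∧
        (PottsBethe.fixedPoints θ q 3).ncard = 4 ∧
        PottsBethe.IsAttracting θ q 3 1 ∧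
        PottsBethe.IsRepelling θ q 3 (PottsBethe.pt θ q y₁) ∧
        PottsBethe.IsRepelling θ q 3 (PottsBethe.pt θ q y₂) ∧
        PottsBethe.IsRepelling θ q 3 (PottsBethe.pt θ q y₃)) ∧
      (PottsBethe.dom θ q \ PottsBethe.unionC θ q y₁ y₂ y₃ ⊆ PottsBethe.basin θ q 3 1 ∧
        PottsBethe.basin θ q 3 1 =
          ⋃ n : ℕ, PottsBethe.preimageIter θ q 3 n (PottsBethe.setA q)) ∧
      ∃ J : Set (ℚ_[p]), J ⊆ PottsBethe.unionC θ q y₁ y₂ y₃ ∧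
        PottsBethe.ConjugateToFullShift (PottsBethe.map θ q 3) J 3 ∧
        Set.univ = PottsBethe.basin θ q 3 1 ∪ J ∪
          ⋃ n : ℕ, PottsBethe.preimageIter θ q 3 n {PottsBethe.pole θ q} := by
  have h : PottsBethe.Admissible θ q := ⟨hθ, hθq, hq⟩
  obtain ⟨ζ, hζ⟩ := PottsBethe.exists_cubeRootsOfUnity hp
  obtain ⟨η, hη, -⟩ := PottsBethe.exists_areRoots hp h hζ
  refine ⟨⟨_, _, _, hη⟩, fun y₁ y₂ y₃ hy => ?_⟩
  have hfp := h.fixedPoints_eq hy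
  have hrep : ∀ y, y = y₁ ∨ y = y₂ ∨ y = y₃ →
      PottsBethe.IsRepelling θ q 3 (PottsBethe.pt θ q y) := fun y hr =>
    PottsBethe.isRepelling_of_mem_trap hp h
      (by rw [hfp]; rcases hr with rfl | rfl | rfl <;> simp) (h.pt_mem_trap hy hr)
  refine ⟨⟨hfp, PottsBethe.ncard_fixedPoints hp h, PottsBethe.isAttracting_one hp h,
    hrep _ (by simp), hrep _ (by simp), hrep _ (by simp)⟩, ⟨fun x hx => ?_, h.basin_eq_iUnion⟩,
    {x | ∀ n, (PottsBethe.map θ q 3)^[n] x ∈ PottsBethe.trap θ q},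
    -- Only the first iterate is needed: the sets C already cover every point whose image lies in
    -- the trap. Contrapositively, a point of the domain outside them is mapped off the trap, hence
    -- into the basin.
    fun x hx => PottsBethe.mem_unionC_of_map_mem_trap hp h hy (hx 1),
    PottsBethe.conjugateToFullShift_trap hp h, h.univ_eq_union⟩
  refine PottsBethe.mem_basin_of_iterate (n := 1) (fun i hi => ?_) (h.mem_basin_of_notMem_trap
    fun ht => hx.2 (PottsBethe.mem_unionC_of_map_mem_trap hp h hy ht))
  rw [Nat.lt_one_iff.1 hi]
  exact hx.1
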